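/- Let $N,R\ge 0$ be integers, $[N]=\{1,\dots,N\}$, $[R]=\{1,\dots,R\}$, and let $F_1,\dots,F_R:2^{[N]}\to\mathbb{R}$ be submodular functions that are normalized, $F_r(\emptyset)=0$, and nonnegative, $F_r\ge 0$. For $x\in\mathbb{R}^N$ and $S\subseteq[N]$ write $x(S)=\sum_{i\in S}x_i$. The base polytope of a set function $F$ on $[N]$ is $\{x\in\mathbb{R}^N : x(S)\le F(S)\ \text{for all } S\subseteq[N],\ x([N])=F([N])\}$; let $B_r$ be the base polytope of $F_r$, and let $C_r=\{(u,\theta)\in\mathbb{R}^N\times\mathbb{R} : \theta\ge 0,\ u\in\theta B_r\}$. For a positive diagonal matrix $W\in\mathbb{R}^{N\times N}$ put $\|x\|_W=\sqrt{\sum_{i}W_{ii}x_i^2}$ for $x\in\mathbb{R}^N$, and $\|y\|_{I(W)}=\sqrt{\sum_{r}\|y_r\|_W^2}$ for $y=(y_1,\dots,y_R)\in(\mathbb{R}^N)^R$; $\|\cdot\|$ is the Euclidean norm and $\|\cdot\|_1$ the $\ell^1$-norm. Let $$\rho=\max_{y_r\in B_r\ \forall r}\sqrt{\sum_{r\in[R]}\|y_r\|_1^2}.$$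 Let $y=(y_r)_{r\in[R]}\in(\mathbb{R}^N)^R$ and $\phi=(\phi_r)_{r\in[R]}\in\mathbb{R}^R$ satisfy $(y_r,\phi_r)\in C_r$ for all $r$, let $\phi'\in\mathbb{R}^R$ have nonnegative entries, let $s$ be any point of the base polytope of $\sum_{r}\phi'_rF_r$, and let $W^{(1)},W^{(2)}\in\mathbb{R}^{N\times N}$ be positive diagonal matrices. Then there is $y'=(y'_r)_{r\in[R]}$ with $y'_r\in\phi'_rB_r$ for all $r$, with $\sum_{r}y'_r=s$, and with $$\|y-y'\|_{I(W^{(1)})}^2+\|\phi-\phi'\|^2\le\mu(W^{(1)},W^{(2)})\Big[\Big\|\sum_{r\in[R]}y_r-s\Big\|_{W^{(2)}}^2+\|\phi-\phi'\|^2\Big],$$ where $$\mu(W^{(1)},W^{(2)})=\max\Big\{\sum_{i\in[N]}W^{(1)}_{ii}\sum_{j\in[N]}\frac{1}{W^{(2)}_{jj}},\ \frac94\,\rho^2\sum_{i\in[N]}W^{(1)}_{ii}+1\Big\}.$$ -/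

import Mathlib

open scoped Pointwise

namespace QDSFM

/-- A set function on the subsets of `[N]` is submodular. -/
def IsSubmodular {N : ℕ} (F : Finset (Fin N) → ℝ) : Prop :=
  ∀ S T : Finset (Fin N), F (S ∪ T) + F (S ∩ T) ≤ F S + F T

/-- The base polytope of a set function `F`:
all `y` with `y(S) ≤ F(S)` for every `S ⊆ [N]` and `y([N]) = F([N])`. -/
def basePolytope {N : ℕ} (F : Finset (Fin N) → ℝ) : Set (Fin N → ℝ) :=
  {y | (∀ S : Finset (Fin N), ∑ i ∈ S, y i ≤ F S) ∧
    ∑ i, y i = F Finset.univ}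

/-- The convex cone `{(y, φ) | φ ≥ 0, y ∈ φ B}` over the base polytope `B` of `F`. -/
def cone {N : ℕ} (F : Finset (Fin N) → ℝ) : Set ((Fin N → ℝ) × ℝ) :=
  {p | 0 ≤ p.2 ∧ p.1 ∈ p.2 • basePolytope F}

/-- A positive diagonal matrix. -/
def IsPosDiag {N : ℕ} (W : Matrix (Fin N) (Fin N) ℝ) : Prop :=
  W.IsDiag ∧ ∀ i, 0 < W i i

/-- The `W`-norm `√(∑ i, W i i * x i ^ 2)`; for `W = 1` it is the Euclidean norm. -/
noncomputable def wNorm {N : ℕ} (W : Matrix (Fin N) (Fin N) ℝ) (x : Fin N → ℝ) : ℝ :=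
  √(∑ i, W i i * x i ^ 2)

/-- The norm induced by the `W`-norm on the `R`-fold product of `ℝ ^ N`. -/
noncomputable def prodNorm {N R : ℕ} (W : Matrix (Fin N) (Fin N) ℝ)
    (y : Fin R → Fin N → ℝ) : ℝ :=
  √(∑ r, wNorm W (y r) ^ 2)

/-- The `ℓ¹`-norm. -/
def l1Norm {N : ℕ} (x : Fin N → ℝ) : ℝ := ∑ i, |x i|

/-- The maximum of `√(∑ r, ‖y r‖₁ ^ 2)` over all `y` with `y r` in the base polytope of `F r`. -/
noncomputable def rho {N R : ℕ} (F : Fin R → Finset (Fin N) → ℝ) : ℝ :=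
  sSup ((fun y : Fin R → Fin N → ℝ => √(∑ r, l1Norm (y r) ^ 2)) ''
    {y | ∀ r, y r ∈ basePolytope (F r)})

/-- The constant of the inequality. -/
noncomputable def mu {N R : ℕ} (F : Fin R → Finset (Fin N) → ℝ)
    (W₁ W₂ : Matrix (Fin N) (Fin N) ℝ) : ℝ :=
  max ((∑ i, W₁ i i) * ∑ j, 1 / W₂ j j) (9 / 4 * rho F ^ 2 * (∑ i, W₁ i i) + 1)

theorem isCompact_basePolytope {N : ℕ} (F : Finset (Fin N) → ℝ) :
    IsCompact (basePolytope F) := by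
  have hcl : IsClosed (basePolytope F) := by
    have h : basePolytope F = (⋂ S : Finset (Fin N), {y | ∑ i ∈ S, y i ≤ F S}) ∩
        {y | ∑ i, y i = F Finset.univ} := by
      ext y; simp [basePolytope]
    rw [h]
    refine (isClosed_iInter fun S => isClosed_le (by fun_prop) (by fun_prop)).inter
      (isClosed_eq (by fun_prop) (by fun_prop))
  refine (isCompact_Icc (a := fun i => F Finset.univ - F (Finset.univ.erase i))
    (b := fun i => F {i})).of_isClosed_subset hcl ?_
  rintro y ⟨h1, h2⟩
  refine ⟨fun i => ?_, fun i => by simpa using h1 {i}⟩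
  have h3 := h1 (Finset.univ.erase i)
  have h4 := Finset.add_sum_erase Finset.univ y (Finset.mem_univ i)
  show F Finset.univ - F (Finset.univ.erase i) ≤ y i
  linarith

/-- The supremum in the definition of `rho` is a maximum. -/
theorem isGreatest_rho {N R : ℕ} (F : Fin R → Finset (Fin N) → ℝ)
    (hF : ∀ r, (basePolytope (F r)).Nonempty) :
    IsGreatest ((fun y : Fin R → Fin N → ℝ => √(∑ r, l1Norm (y r) ^ 2)) ''
      {y | ∀ r, y r ∈ basePolytope (F r)}) (rho F) := by
  have hc : IsCompact {y : Fin R → Fin N → ℝ | ∀ r, y r ∈ basePolytope (F r)} :=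
    isCompact_pi_infinite fun r => isCompact_basePolytope (F r)
  have hcont : Continuous (fun y : Fin R → Fin N → ℝ => √(∑ r, l1Norm (y r) ^ 2)) := by
    unfold l1Norm; fun_prop
  choose y hy using hF
  exact (hc.image hcont).isGreatest_sSup ⟨_, y, hy, rfl⟩

end QDSFM

namespace QDSFM

/-! Write `y r = φ r • b r`. The point `z r = φ' r • b r` already lies in the polytopes prescribed
for `y'`, so it remains to correct its sum to `s` cheaply. `exists_decomposition` does this by
moving mass along augmenting directions, as in a flow argument. Each unit of deficit removed costs
every coordinate at most one unit of decrease, summed over `r`, and the receiving coordinate none.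
The total decrease at `i` is thus at most the initial deficit away from `i`. With `w = ∑ r, y r - s`
and `u r = (φ r - φ' r) • b r`, let `c` be the `ℓ¹`-norm of `w` and `d` the sum of those of the `u
r`. `sum_posPart_sub_le` then bounds the positive and the negative parts of `y - y'` at each
coordinate by `(c + d) / 2`, so its squares there sum to at most `c ^ 2 + d ^ 2`. Cauchy–Schwarz
bounds `c` by the `W₂`-norm of `w` and `d` by `rho F` times the norm of `φ - φ'`. -/

/-- The product of the base polytopes of the family `G`. -/
def baseProduct {N R : ℕ} (G : Fin R → Finset (Fin N) → ℝ) : Set (Fin R → Fin N → ℝ) :=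
  {q | ∀ r, q r ∈ basePolytope (G r)}

/-! ### Convexity and compactness. -/

theorem convex_basePolytope {N : ℕ} (F : Finset (Fin N) → ℝ) : Convex ℝ (basePolytope F) := by
  rintro x ⟨hx, hx'⟩ y ⟨hy, hy'⟩ a b ha hb hab
  have key : ∀ S : Finset (Fin N),
      ∑ i ∈ S, (a • x + b • y) i = a * ∑ i ∈ S, x i + b * ∑ i ∈ S, y i := fun S => by
    simp [Finset.sum_add_distrib, Finset.mul_sum]
  refine ⟨fun S => ?_, ?_⟩
  · rw [key]
    have h1 := mul_le_mul_of_nonneg_left (hx S) ha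
    have h2 := mul_le_mul_of_nonneg_left (hy S) hb
    have h3 : a * F S + b * F S = F S := by rw [← add_mul, hab, one_mul]
    linarith
  · rw [key, hx', hy', ← add_mul, hab, one_mul]

theorem convex_baseProduct {N R : ℕ} (G : Fin R → Finset (Fin N) → ℝ) :
    Convex ℝ (baseProduct G) :=
  fun _ hx _ hy _ _ ha hb hab r => convex_basePolytope (G r) (hx r) (hy r) ha hb hab

theorem isCompact_baseProduct {N R : ℕ} (G : Fin R → Finset (Fin N) → ℝ) :
    IsCompact (baseProduct G) :=
  isCompact_pi_infinite fun r => isCompact_basePolytope (G r)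

/-! ### Exchanges and tight sets. -/

/-- If mass cannot be moved from `i` to `j` inside the base polytope, some tight set separates
`j` from `i`. -/
theorem exists_tight_of_no_exchange {N : ℕ} {G : Finset (Fin N) → ℝ} {q : Fin N → ℝ}
    (hq : q ∈ basePolytope G) {i j : Fin N}
    (h : ∀ ε > (0 : ℝ), q + ε • (Pi.single j 1 - Pi.single i 1 : Fin N → ℝ) ∉ basePolytope G)
    (hij : i ≠ j) :
    ∃ T : Finset (Fin N), j ∈ T ∧ i ∉ T ∧ ∑ k ∈ T, q k = G T := by
  by_contra! hT
  -- Only sets containing `j` but not `i` gain mass in the exchange, so their least slack is a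
  -- feasible step size.
  obtain ⟨T₀, hT₀, hmin⟩ := Finset.exists_min_image
    (Finset.univ.filter fun T : Finset (Fin N) => j ∈ T ∧ i ∉ T)
    (fun T => G T - ∑ k ∈ T, q k) ⟨{j}, by simp [hij]⟩
  simp only [Finset.mem_filter, Finset.mem_univ, true_and] at hT₀ hmin
  have hpos : 0 < G T₀ - ∑ k ∈ T₀, q k :=
    sub_pos.2 (lt_of_le_of_ne (hq.1 T₀) (hT T₀ hT₀.1 hT₀.2))
  have key : ∀ (ε : ℝ) (S : Finset (Fin N)),
      ∑ k ∈ S, (q + ε • (Pi.single j 1 - Pi.single i 1 : Fin N → ℝ)) k =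
        ∑ k ∈ S, q k + ε * ((if j ∈ S then 1 else 0) - (if i ∈ S then 1 else 0)) := by
    intro ε S
    simp [Finset.sum_add_distrib, ← Finset.mul_sum, Pi.single_apply]
  refine h _ hpos ⟨fun S => ?_, ?_⟩
  · rw [key]
    have h1 := hq.1 S
    by_cases hj : j ∈ S <;> by_cases hi : i ∈ S <;> simp only [hj, hi, if_true, if_false]
    · linarith
    · have := hmin S ⟨hj, hi⟩
      linarith
    · linarith
    · linarith
  · rw [key, hq.2]; simp

/-- Uncrossing: `q` is modular, so submodularity leaves no slack for either set. -/
theorem tight_inter_union {N : ℕ} {G : Finset (Fin N) → ℝ} (hG : IsSubmodular G)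
    {q : Fin N → ℝ} (hq : q ∈ basePolytope G) {S T : Finset (Fin N)}
    (hS : ∑ k ∈ S, q k = G S) (hT : ∑ k ∈ T, q k = G T) :
    ∑ k ∈ S ∩ T, q k = G (S ∩ T) ∧ ∑ k ∈ S ∪ T, q k = G (S ∪ T) := by
  have h1 := hq.1 (S ∩ T)
  have h2 := hq.1 (S ∪ T)
  have h3 := hG S T
  have h4 := Finset.sum_union_inter (s₁ := S) (s₂ := T) (f := q)
  constructor <;> linarith

/-- A set into which no mass can be moved is tight. -/
theorem tight_of_no_exchange {N : ℕ} {G : Finset (Fin N) → ℝ} (hG : IsSubmodular G)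
    (hG0 : G ∅ = 0) {q : Fin N → ℝ} (hq : q ∈ basePolytope G) (Z : Finset (Fin N))
    (h : ∀ i ∉ Z, ∀ j ∈ Z, ∀ ε > (0 : ℝ),
      q + ε • (Pi.single j 1 - Pi.single i 1 : Fin N → ℝ) ∉ basePolytope G) :
    ∑ k ∈ Z, q k = G Z := by
  have h1 : ∀ j ∈ Z, ∃ T ⊆ Z, j ∈ T ∧ ∑ k ∈ T, q k = G T := by
    intro j hj
    -- Starting from the tight set `univ`, intersect with a tight set separating `j` from each `i`
    -- outside `Z`; the union of the resulting sets over `j ∈ Z` is `Z`.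
    have h2 : ∀ A : Finset (Fin N), (∀ i ∈ A, i ∉ Z) →
        ∃ T : Finset (Fin N), (∀ i ∈ A, i ∉ T) ∧ j ∈ T ∧ ∑ k ∈ T, q k = G T := by
      intro A
      induction A using Finset.induction_on with
      | empty => exact fun _ => ⟨Finset.univ, by simp, by simp, hq.2⟩
      | insert a A _ ih =>
        intro hA
        obtain ⟨T, hT1, hT2, hT3⟩ := ih fun i hi => hA i (Finset.mem_insert_of_mem hi)
        have ha := hA a (Finset.mem_insert_self _ _)
        obtain ⟨T', hT1', hT2', hT3'⟩ := exists_tight_of_no_exchange hq (h a ha j hj)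
          (fun e => ha (e ▸ hj))
        refine ⟨T ∩ T', ?_, Finset.mem_inter.2 ⟨hT2, hT1'⟩, (tight_inter_union hG hq hT3 hT3').1⟩
        intro i hi
        rcases Finset.mem_insert.1 hi with rfl | hi
        · exact fun hm => hT2' (Finset.mem_inter.1 hm).2
        · exact fun hm => hT1 i hi (Finset.mem_inter.1 hm).1
    obtain ⟨T, hT1, hT2, hT3⟩ := h2 Zᶜ (by simp)
    refine ⟨T, fun i hi => ?_, hT2, hT3⟩
    by_contra hiZ
    exact hT1 i (by simpa using hiZ) hi
  have h3 : ∀ A ⊆ Z, ∃ T, A ⊆ T ∧ T ⊆ Z ∧ ∑ k ∈ T, q k = G T := by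
    intro A
    induction A using Finset.induction_on with
    | empty => exact fun _ => ⟨∅, by simp, by simp, by simp [hG0]⟩
    | insert a A _ ih =>
      intro hA
      obtain ⟨hA1, hA2⟩ := Finset.insert_subset_iff.1 hA
      obtain ⟨T, hT1, hT2, hT3⟩ := ih hA2
      obtain ⟨T', hT1', hT2', hT3'⟩ := h1 a hA1
      exact ⟨T' ∪ T, Finset.insert_subset (Finset.mem_union_left _ hT2')
        (hT1.trans Finset.subset_union_right), Finset.union_subset hT1' hT2,
        (tight_inter_union hG hq hT3' hT3).2⟩
  obtain ⟨T, hT1, hT2, hT3⟩ := h3 Z subset_rfl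
  rwa [hT1.antisymm hT2]

/-! ### Augmenting directions. -/

theorem convex_add_smul_mem {E : Type*} [AddCommGroup E] [Module ℝ E] {K : Set E}
    (hK : Convex ℝ K) {q D : E} (hq : q ∈ K) {δ η : ℝ} (hη : 0 ≤ η) (hηδ : η ≤ δ)
    (h : q + δ • D ∈ K) : q + η • D ∈ K := by
  rcases hη.eq_or_lt with rfl | hpos
  · simpa using hq
  have hδ : 0 < δ := hpos.trans_le hηδ
  have := hK.add_smul_mem hq h ⟨(div_pos hpos hδ).le, (div_le_one hδ).2 hηδ⟩
  rwa [smul_smul, div_mul_cancel₀ _ hδ.ne'] at this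

/-- Weights `ε / (δ + ε)` and `δ / (δ + ε)` equalize the two step lengths. Feasible directions can
therefore be added, and exchanges in a path need not be checked for interference. -/
theorem convex_add_smul_add_mem {E : Type*} [AddCommGroup E] [Module ℝ E] {K : Set E}
    (hK : Convex ℝ K) {q D D' : E} {δ ε : ℝ} (hδ : 0 < δ) (hε : 0 < ε)
    (h : q + δ • D ∈ K) (h' : q + ε • D' ∈ K) :
    q + (δ * ε / (δ + ε)) • (D + D') ∈ K := by
  have hs : 0 < δ + ε := add_pos hδ hε
  have := hK h h' (a := ε / (δ + ε)) (b := δ / (δ + ε)) (by positivity) (by positivity)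
    (by field_simp; ring)
  convert this using 1
  have e : q = (ε / (δ + ε)) • q + (δ / (δ + ε)) • q := by
    rw [← add_smul, ← add_div, add_comm ε δ, div_self hs.ne', one_smul]
  nth_rewrite 1 [e]
  simp only [smul_add, smul_smul]
  rw [div_mul_eq_mul_div, div_mul_eq_mul_div, mul_comm ε δ]
  abel

/-- `D` is a feasible direction at `q` that moves one unit from `i` to `x` through `Z`, lowering
each coordinate in `Z \ {x}` by at most one in total. -/
structure IsAugmenting {N R : ℕ} (G : Fin R → Finset (Fin N) → ℝ) (q : Fin R → Fin N → ℝ)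
    (Z : Finset (Fin N)) (i x : Fin N) (D : Fin R → Fin N → ℝ) : Prop where
  feasible : ∃ δ > (0 : ℝ), q + δ • D ∈ baseProduct G
  sum_eq : ∑ r, D r = Pi.single x 1 - Pi.single i 1
  loss_le : ∀ j, ∑ r, max (-(D r j)) 0 ≤ if j ∈ Z ∧ j ≠ x then 1 else 0

/-- The added exchange lowers only `i'`, which lies outside `Z` and so has lost nothing before; the
unit bound on losses survives. -/
theorem IsAugmenting.insert_exchange {N R : ℕ} {G : Fin R → Finset (Fin N) → ℝ}
    {q : Fin R → Fin N → ℝ} (hq : q ∈ baseProduct G) {Z : Finset (Fin N)} {i i' x : Fin N}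
    {D : Fin R → Fin N → ℝ} (h : IsAugmenting G q Z i x D) (hi' : i' ∉ Z) (hx : x ∈ Z)
    {r : Fin R} {ε : ℝ} (hε : 0 < ε)
    (hmem : q r + ε • (Pi.single i 1 - Pi.single i' 1 : Fin N → ℝ) ∈ basePolytope (G r)) :
    IsAugmenting G q (insert i' Z) i' x
      (D + Pi.single r (Pi.single i 1 - Pi.single i' 1)) := by
  obtain ⟨⟨δ, hδ, hD⟩, hsum, hloss⟩ := h
  refine ⟨⟨δ * ε / (δ + ε), by positivity,
    convex_add_smul_add_mem (convex_baseProduct G) hδ hε hD ?_⟩, ?_, fun j => ?_⟩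
  · intro r'
    by_cases hr : r' = r
    · subst hr; simpa using hmem
    · simpa [hr] using hq r'
  · simp only [Pi.add_apply, Finset.sum_add_distrib, hsum, Finset.sum_pi_single', Finset.mem_univ]
    simp
  · have hxi' : i' ≠ x := fun e => hi' (e ▸ hx)
    have h1 : ∀ r', max (-((D + Pi.single r (Pi.single i 1 - Pi.single i' 1) :
        Fin R → Fin N → ℝ) r' j)) 0 ≤ max (-(D r' j)) 0 + if r' = r then (if j = i' then 1 else 0) else 0 := by
      intro r'
      by_cases hr : r' = r
      · subst hr
        simp only [Pi.add_apply, Pi.single_eq_same, Pi.sub_apply, if_true]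
        have a : (0 : ℝ) ≤ (Pi.single i 1 : Fin N → ℝ) j := by
          rw [Pi.single_apply]; split_ifs <;> norm_num
        have b : (Pi.single i' 1 : Fin N → ℝ) j = if j = i' then 1 else 0 := Pi.single_apply ..
        have c : (0 : ℝ) ≤ if j = i' then 1 else 0 := by split_ifs <;> norm_num
        rw [b]
        refine max_le ?_ ?_
        · linarith [le_max_left (-(D r' j)) 0]
        · linarith [le_max_right (-(D r' j)) 0]
      · simp [hr]
    refine (Finset.sum_le_sum fun r' _ => h1 r').trans ?_
    rw [Finset.sum_add_distrib, Finset.sum_ite_eq' Finset.univ r]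
    have h2 := hloss j
    by_cases hj : j = i'
    · subst hj
      simp only [hi', false_and, if_false] at h2
      simp [hxi', h2]
    · simpa [hj] using h2

/-- If `∑ r, q r` differs from a point `s` of the base polytope of the sum, there is an
augmenting direction from a coordinate of surplus to one of deficit. -/
theorem exists_isAugmenting {N R : ℕ} {G : Fin R → Finset (Fin N) → ℝ}
    (hsub : ∀ r, IsSubmodular (G r)) (hG0 : ∀ r, G r ∅ = 0)
    {q : Fin R → Fin N → ℝ} (hq : q ∈ baseProduct G) {s : Fin N → ℝ}
    (hs : s ∈ basePolytope fun S => ∑ r, G r S) (hpos : ∃ x, 0 < s x - ∑ r, q r x) :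
    ∃ Z i x D, s i - ∑ r, q r i < 0 ∧ 0 < s x - ∑ r, q r x ∧ IsAugmenting G q Z i x D := by
  classical
  set v : Fin N → ℝ := fun j => s j - ∑ r, q r j with hv
  -- `v` is the deficit. A maximal `Z` with `P` plays the role of the set of vertices from which a
  -- deficit coordinate can be reached.
  let P : Finset (Fin N) → Prop := fun Z =>
    (∀ x, 0 < v x → x ∈ Z) ∧ ∀ i ∈ Z, ∃ x D, 0 < v x ∧ IsAugmenting G q Z i x D
  have hP0 : P (Finset.univ.filter fun x => 0 < v x) := by
    refine ⟨by simp, fun i hi => ⟨i, 0, by simpa using hi, ⟨⟨1, one_pos, by simpa using hq⟩,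
      by simp, fun j => ?_⟩⟩⟩
    simp only [Pi.zero_apply, neg_zero, max_self, Finset.sum_const_zero]
    split_ifs <;> norm_num
  obtain ⟨Z, hZ⟩ := (Set.toFinite {Z | P Z}).exists_maximal ⟨_, hP0⟩
  obtain ⟨hZX, hZaug⟩ : P Z := hZ.1
  by_cases hneg : ∃ i ∈ Z, v i < 0
  · obtain ⟨i, hi, hvi⟩ := hneg
    obtain ⟨x, D, hx, hD⟩ := hZaug i hi
    exact ⟨Z, i, x, D, hvi, hx, hD⟩
  exfalso
  push Not at hneg
  -- An exchange from outside into `Z` would enlarge `Z`. With `Z` tight for every `r`, `v` has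
  -- nonpositive sum over `Z`, although it is nonnegative there and positive somewhere.
  have htight : ∀ r, ∑ k ∈ Z, q r k = G r Z := by
    intro r
    refine tight_of_no_exchange (hsub r) (hG0 r) (hq r) Z fun i' hi' i hi ε hε hmem => ?_
    obtain ⟨x, D, hx, hD⟩ := hZaug i hi
    have hP : P (insert i' Z) := by
      refine ⟨fun x hx => Finset.mem_insert_of_mem (hZX x hx), fun j hj => ?_⟩
      rcases Finset.mem_insert.1 hj with rfl | hj
      · exact ⟨x, _, hx, hD.insert_exchange hq hi' (hZX x hx) hε hmem⟩
      · obtain ⟨x, D, hx, hD⟩ := hZaug j hj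
        refine ⟨x, D, hx, hD.feasible, hD.sum_eq, fun k => (hD.loss_le k).trans ?_⟩
        by_cases hk : k ∈ Z <;> by_cases hkx : k = x <;> simp [hk, hkx]
        split_ifs <;> norm_num
    exact hi' (hZ.2 hP (Finset.subset_insert _ _) (Finset.mem_insert_self _ _))
  obtain ⟨x, hx⟩ := hpos
  have h1 : 0 < ∑ k ∈ Z, v k := Finset.sum_pos' hneg ⟨x, hZX x hx, hx⟩
  have h2 := hs.1 Z
  simp only [hv, Finset.sum_sub_distrib] at h1
  rw [Finset.sum_comm] at h1
  simp only [htight] at h1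
  linarith

/-! ### Decomposition with controlled losses. -/

/-- A point of the base polytope of a sum decomposes along the summands, close to a given point
of the product of the base polytopes. -/
theorem exists_decomposition {N R : ℕ} {G : Fin R → Finset (Fin N) → ℝ}
    (hsub : ∀ r, IsSubmodular (G r)) (hG0 : ∀ r, G r ∅ = 0)
    {z : Fin R → Fin N → ℝ} (hz : z ∈ baseProduct G) {s : Fin N → ℝ}
    (hs : s ∈ basePolytope fun S => ∑ r, G r S) :
    ∃ q ∈ baseProduct G, (∀ i, ∑ r, q r i = s i) ∧
      ∀ i, ∑ r, max (-(q r i - z r i)) 0 ≤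
        ∑ j ∈ Finset.univ.erase i, max (s j - ∑ r, z r j) 0 := by
  classical
  -- The invariant: loss so far plus remaining deficit away from `i` never exceeds the initial
  -- deficit away from `i`. Minimizing the deficit over the compact set `M` replaces a terminating
  -- algorithm.
  set M : Set (Fin R → Fin N → ℝ) := baseProduct G ∩
    {q | ∀ i, ∑ r, max (-(q r i - z r i)) 0 +
      ∑ j ∈ Finset.univ.erase i, max (s j - ∑ r, q r j) 0 ≤
        ∑ j ∈ Finset.univ.erase i, max (s j - ∑ r, z r j) 0} with hM
  have hMc : IsCompact M := by
    refine (isCompact_baseProduct G).inter_right ?_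
    rw [Set.ofPred_forall]
    exact isClosed_iInter fun i => isClosed_le (by fun_prop) (by fun_prop)
  obtain ⟨q, hqM, hmin⟩ := hMc.exists_isMinOn
    (f := fun q : Fin R → Fin N → ℝ => ∑ j, max (s j - ∑ r, q r j) 0)
    ⟨z, hz, fun i => by simp⟩ (by fun_prop)
  obtain ⟨hq, hqb⟩ := hqM
  have hle : ∀ j, s j - ∑ r, q r j ≤ 0 := by
    by_contra! hpos
    obtain ⟨Z, i, x, D, hi, hx, ⟨δ, hδ, hD⟩, hsum, hloss⟩ :=
      exists_isAugmenting hsub hG0 hq hs hpos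
    -- The step neither turns the surplus at `i` into a deficit nor overshoots at `x`, so the total
    -- deficit drops by exactly `η`.
    obtain ⟨η, hη, hηδ, hηi, hηx⟩ : ∃ η > 0, η ≤ δ ∧ η ≤ -(s i - ∑ r, q r i) ∧
        η ≤ s x - ∑ r, q r x :=
      ⟨min δ (min (-(s i - ∑ r, q r i)) (s x - ∑ r, q r x)),
        lt_min hδ (lt_min (by linarith) hx), min_le_left _ _,
        (min_le_right _ _).trans (min_le_left _ _), (min_le_right _ _).trans (min_le_right _ _)⟩
    have hix : i ≠ x := by rintro rfl; linarith
    have hmem := convex_add_smul_mem (convex_baseProduct G) hq hη.le hηδ hD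
    have hv : ∀ j, s j - ∑ r, (q + η • D) r j =
        s j - ∑ r, q r j - η * ((if j = x then 1 else 0) - if j = i then 1 else 0) := by
      intro j
      have h1 := congrFun hsum j
      simp only [Finset.sum_apply, Pi.sub_apply, Pi.single_apply] at h1
      simp only [Pi.add_apply, Pi.smul_apply, smul_eq_mul, Finset.sum_add_distrib,
        ← Finset.mul_sum, h1]
      ring
    have hmax : ∀ j, max (s j - ∑ r, (q + η • D) r j) 0 =
        max (s j - ∑ r, q r j) 0 - if j = x then η else 0 := by
      intro j
      rw [hv]
      by_cases hjx : j = x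
      · subst hjx
        simp only [if_true, if_neg hix.symm]
        rw [max_eq_left (by linarith), max_eq_left (by linarith)]
        ring
      · by_cases hji : j = i
        · subst hji
          simp only [if_true, if_neg hjx]
          rw [max_eq_right (by linarith), max_eq_right (by linarith)]
          ring
        · simp [hjx, hji]
    have hM' : q + η • D ∈ M := by
      refine ⟨hmem, fun k => ?_⟩
      have h1 : ∑ r, max (-((q + η • D) r k - z r k)) 0 ≤
          ∑ r, max (-(q r k - z r k)) 0 + η * ∑ r, max (-(D r k)) 0 := by
        rw [Finset.mul_sum, ← Finset.sum_add_distrib]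
        refine Finset.sum_le_sum fun r _ => ?_
        have a := le_max_left (-(q r k - z r k)) 0
        have b := le_max_right (-(q r k - z r k)) 0
        have c := mul_le_mul_of_nonneg_left (le_max_left (-(D r k)) 0) hη.le
        have d := mul_nonneg hη.le (le_max_right (-(D r k)) 0)
        refine max_le ?_ (by linarith)
        simp only [Pi.add_apply, Pi.smul_apply, smul_eq_mul]
        linarith
      have h2 := mul_le_mul_of_nonneg_left (hloss k) hη.le
      -- The loss at `k ≠ x` is paid for by the drop `η` of the deficit at `x`; for `k = x` there is
      -- neither loss nor drop.
      have h3 : η * (if k ∈ Z ∧ k ≠ x then (1 : ℝ) else 0) ≤ if k = x then 0 else η := by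
        by_cases hkx : k = x
        · simp [hkx]
        · by_cases hk : k ∈ Z <;> simp [hkx, hk, hη.le]
      have h4 := hqb k
      simp only [hmax, Finset.sum_sub_distrib, Finset.sum_ite_eq', Finset.mem_erase,
        Finset.mem_univ, and_true]
      by_cases hkx : k = x
      · simp only [hkx, if_true, ne_eq, not_true, if_false] at *
        linarith
      · simp only [hkx, if_false, ne_eq, Ne.symm (a := k) hkx, not_false_iff, if_true] at *
        linarith
    have h5 := hmin hM'
    simp only [Set.mem_ofPred_eq, hmax, Finset.sum_sub_distrib, Finset.sum_ite_eq',
      Finset.mem_univ, if_true] at h5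
    linarith
  -- Both sides have the same total mass, so absence of deficit forces equality.
  have hzero : ∀ j, s j - ∑ r, q r j = 0 := by
    have h1 : ∑ j, (s j - ∑ r, q r j) = 0 := by
      rw [Finset.sum_sub_distrib, hs.2, Finset.sum_comm, sub_eq_zero]
      exact Finset.sum_congr rfl fun r _ => (hq r).2.symm
    intro j
    exact (Finset.sum_eq_zero_iff_of_nonpos fun j _ => hle j).1 h1 j (Finset.mem_univ j)
  refine ⟨q, hq, fun i => by linarith [hzero i], fun i => ?_⟩
  simpa [hzero] using hqb i

/-! ### Scaling and norm estimates. -/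

/-- For `c = 0` the constraints force `x = 0`, and nonemptiness is needed because `0 • ∅ = ∅`. -/
theorem mem_smul_basePolytope {N : ℕ} {F : Finset (Fin N) → ℝ} (hF : (basePolytope F).Nonempty)
    {c : ℝ} (hc : 0 ≤ c) {x : Fin N → ℝ} (hx : x ∈ basePolytope fun S => c * F S) :
    x ∈ c • basePolytope F := by
  rcases hc.eq_or_lt with rfl | hpos
  · obtain ⟨b, hb⟩ := hF
    refine ⟨b, hb, ?_⟩
    simp only [basePolytope, zero_mul, Set.mem_ofPred_eq] at hx
    have h1 : ∀ i, x i ≤ 0 := fun i => by simpa using hx.1 {i}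
    ext i
    simpa using ((Finset.sum_eq_zero_iff_of_nonpos fun j _ => h1 j).1 hx.2 i
      (Finset.mem_univ i)).symm
  · refine ⟨c⁻¹ • x, ⟨fun S => ?_, ?_⟩, by simp [smul_smul, hpos.ne']⟩
    · simp only [Pi.smul_apply, smul_eq_mul, ← Finset.mul_sum]
      rw [inv_mul_le_iff₀ hpos]
      exact hx.1 S
    · simp only [Pi.smul_apply, smul_eq_mul, ← Finset.mul_sum]
      rw [hx.2, inv_mul_cancel_left₀ hpos.ne']

theorem smul_mem_basePolytope {N : ℕ} {F : Finset (Fin N) → ℝ} {b : Fin N → ℝ}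
    (hb : b ∈ basePolytope F) {c : ℝ} (hc : 0 ≤ c) :
    c • b ∈ basePolytope fun S => c * F S := by
  refine ⟨fun S => ?_, ?_⟩
  · simp only [Pi.smul_apply, smul_eq_mul, ← Finset.mul_sum]
    exact mul_le_mul_of_nonneg_left (hb.1 S) hc
  · simp only [Pi.smul_apply, smul_eq_mul, ← Finset.mul_sum, hb.2]

/-- The second square is that of the sum of negative parts. Squares of nonnegative numbers sum to at
most the square of their sum. -/
theorem sum_sq_le_of_sum_posPart {ι : Type*} (t : Finset ι) (a : ι → ℝ) :
    ∑ r ∈ t, a r ^ 2 ≤ (∑ r ∈ t, max (a r) 0) ^ 2 + (∑ r ∈ t, max (a r) 0 - ∑ r ∈ t, a r) ^ 2 := by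
  have hsq : ∀ f : ι → ℝ, (∀ r ∈ t, 0 ≤ f r) → ∑ r ∈ t, f r ^ 2 ≤ (∑ r ∈ t, f r) ^ 2 :=
    fun f hf => Finset.sum_sq_le_sq_sum_of_nonneg hf
  rw [← Finset.sum_sub_distrib]
  refine le_trans ?_ (add_le_add (hsq (fun r => max (a r) 0) fun r _ => le_max_right _ _)
    (hsq (fun r => max (a r) 0 - a r) fun r _ => sub_nonneg.2 (le_max_left _ _)))
  rw [← Finset.sum_add_distrib]
  refine Finset.sum_le_sum fun r _ => ?_
  rcases le_total (a r) 0 with h | h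
  · simp [max_eq_right h]
  · simp [max_eq_left h]

/-- The coordinatewise bound: with `v = ∑ r, u r - w` of zero sum and losses
`∑ r, max (-(t r i)) 0` at most the positive part of `v` away from `i`, the positive parts of
`u r i - t r i` sum to at most half of the `ℓ¹` data. -/
theorem sum_posPart_sub_le {N R : ℕ} (u t : Fin R → Fin N → ℝ) (w : Fin N → ℝ)
    (hsum : ∑ j, (∑ r, u r j - w j) = 0) (i : Fin N)
    (hloss : ∑ r, max (-(t r i)) 0 ≤
      ∑ j ∈ Finset.univ.erase i, max (∑ r, u r j - w j) 0) :
    ∑ r, max (u r i - t r i) 0 ≤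
      (∑ j, |w j| + ∑ r, ∑ j, |u r j| - |w i| + w i) / 2 := by
  have h1 : ∑ r, max (u r i - t r i) 0 ≤ ∑ r, max (u r i) 0 + ∑ r, max (-(t r i)) 0 := by
    rw [← Finset.sum_add_distrib]
    refine Finset.sum_le_sum fun r _ => ?_
    have := le_max_left (u r i) 0
    have := le_max_right (u r i) 0
    have := le_max_left (-(t r i)) 0
    have := le_max_right (-(t r i)) 0
    exact max_le (by linarith) (by linarith)
  -- A positive part is `(|v| + v) / 2`. By `hsum` the terms `v` away from `i` sum to `-v i`, which
  -- cancels `∑ r, u r i` in `h3` and leaves `w i`.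
  have h2 : ∑ j ∈ Finset.univ.erase i, max (∑ r, u r j - w j) 0 ≤
      ∑ j ∈ Finset.univ.erase i, (∑ r, |u r j| + |w j| + (∑ r, u r j - w j)) / 2 := by
    refine Finset.sum_le_sum fun j _ => ?_
    have a := Finset.abs_sum_le_sum_abs (fun r => u r j) Finset.univ
    have b := abs_sub (∑ r, u r j) (w j)
    have c := le_abs_self (∑ r, u r j - w j)
    have d := neg_abs_le (∑ r, u r j - w j)
    exact max_le (by linarith) (by linarith)
  have h3 : ∑ r, max (u r i) 0 = (∑ r, |u r i| + ∑ r, u r i) / 2 := by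
    rw [← Finset.sum_add_distrib, Finset.sum_div]
    refine Finset.sum_congr rfl fun r _ => ?_
    rcases le_total (u r i) 0 with h | h
    · rw [max_eq_right h, abs_of_nonpos h]; ring
    · rw [max_eq_left h, abs_of_nonneg h]; ring
  rw [← Finset.sum_div, Finset.sum_add_distrib, Finset.sum_add_distrib] at h2
  have e1 := Finset.add_sum_erase Finset.univ (fun j => ∑ r, |u r j|) (Finset.mem_univ i)
  have e2 := Finset.add_sum_erase Finset.univ (fun j => |w j|) (Finset.mem_univ i)
  have e3 := Finset.add_sum_erase Finset.univ (fun j => ∑ r, u r j - w j) (Finset.mem_univ i)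
  have e4 : ∑ r, ∑ j, |u r j| = ∑ j, ∑ r, |u r j| := Finset.sum_comm
  linarith

theorem wNorm_sq {N : ℕ} {W : Matrix (Fin N) (Fin N) ℝ} (hW : ∀ i, 0 ≤ W i i) (x : Fin N → ℝ) :
    wNorm W x ^ 2 = ∑ i, W i i * x i ^ 2 :=
  Real.sq_sqrt (Finset.sum_nonneg fun i _ => mul_nonneg (hW i) (sq_nonneg _))

theorem prodNorm_sq {N R : ℕ} {W : Matrix (Fin N) (Fin N) ℝ} (hW : ∀ i, 0 ≤ W i i)
    (y : Fin R → Fin N → ℝ) : prodNorm W y ^ 2 = ∑ i, W i i * ∑ r, y r i ^ 2 := by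
  rw [prodNorm, Real.sq_sqrt (Finset.sum_nonneg fun _ _ => sq_nonneg _)]
  simp only [wNorm_sq hW, Finset.mul_sum]
  exact Finset.sum_comm

/-- Cauchy–Schwarz between the `ℓ¹`-norm and the `W`-norm. -/
theorem l1Norm_sq_le {N : ℕ} {W : Matrix (Fin N) (Fin N) ℝ} (hW : ∀ i, 0 < W i i)
    (x : Fin N → ℝ) : l1Norm x ^ 2 ≤ (∑ j, 1 / W j j) * wNorm W x ^ 2 := by
  rw [wNorm_sq fun i => (hW i).le]
  refine Finset.sum_sq_le_sum_mul_sum_of_sq_le_mul _ (fun i _ => (one_div_pos.2 (hW i)).le)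
    (fun i _ => mul_nonneg (hW i).le (sq_nonneg _)) fun i _ => le_of_eq ?_
  have := (hW i).ne'
  rw [sq_abs]; field_simp

theorem sum_l1Norm_sq_le_rho_sq {N R : ℕ} {F : Fin R → Finset (Fin N) → ℝ}
    {b : Fin R → Fin N → ℝ} (hb : ∀ r, b r ∈ basePolytope (F r)) :
    ∑ r, l1Norm (b r) ^ 2 ≤ rho F ^ 2 := by
  have h := (isGreatest_rho F fun r => ⟨b r, hb r⟩).2 ⟨b, hb, rfl⟩
  rw [← Real.sq_sqrt (Finset.sum_nonneg fun r _ => sq_nonneg (l1Norm (b r)))]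
  exact pow_le_pow_left₀ (Real.sqrt_nonneg _) h 2

end QDSFM

/-! ### The inequality. -/

theorem lemma4p2 {N R : ℕ} (F : Fin R → Finset (Fin N) → ℝ)
    (hsub : ∀ r, QDSFM.IsSubmodular (F r))
    (hnorm : ∀ r, F r ∅ = 0)
    (hnonneg : ∀ r S, 0 ≤ F r S)
    (y : Fin R → Fin N → ℝ) (φ : Fin R → ℝ)
    (hy : ∀ r, (y r, φ r) ∈ QDSFM.cone (F r))
    (φ' : Fin R → ℝ) (hφ' : ∀ r, 0 ≤ φ' r)
    (s : Fin N → ℝ)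
    (hs : s ∈ QDSFM.basePolytope (fun S => ∑ r, φ' r * F r S))
    (W₁ W₂ : Matrix (Fin N) (Fin N) ℝ)
    (hW₁ : QDSFM.IsPosDiag W₁) (hW₂ : QDSFM.IsPosDiag W₂) :
    ∃ y' : Fin R → Fin N → ℝ,
      (∀ r, y' r ∈ φ' r • QDSFM.basePolytope (F r)) ∧
      ∑ r, y' r = s ∧
      QDSFM.prodNorm W₁ (y - y') ^ 2 + QDSFM.wNorm 1 (φ - φ') ^ 2 ≤
        QDSFM.mu F W₁ W₂ *
          (QDSFM.wNorm W₂ (∑ r, y r - s) ^ 2 + QDSFM.wNorm 1 (φ - φ') ^ 2) := by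
  choose b hb hyb using fun r => (hy r).2
  simp only at hyb
  have hsub' : ∀ r, QDSFM.IsSubmodular fun S => φ' r * F r S := fun r S T => by
    have := mul_le_mul_of_nonneg_left (hsub r S T) (hφ' r)
    simp only
    linarith
  have hz : (fun r => φ' r • b r) ∈ QDSFM.baseProduct fun r S => φ' r * F r S :=
    fun r => QDSFM.smul_mem_basePolytope (hb r) (hφ' r)
  obtain ⟨y', hy', hsum, hloss⟩ := QDSFM.exists_decomposition hsub'
    (fun r => by simp [hnorm r]) hz hs
  refine ⟨y', fun r => QDSFM.mem_smul_basePolytope ⟨b r, hb r⟩ (hφ' r) (hy' r),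
    funext fun i => by simpa using hsum i, ?_⟩
  set w : Fin N → ℝ := ∑ r, y r - s with hw
  set u : Fin R → Fin N → ℝ := fun r => (φ r - φ' r) • b r with hu
  have hyz : ∀ r i, y r i - φ' r * b r i = u r i := fun r i => by
    rw [← hyb r]; simp [hu, sub_mul]
  have hv : ∀ j, s j - ∑ r, (φ' r • b r) j = ∑ r, u r j - w j := fun j => by
    simp only [← hyz, hw, Pi.sub_apply, Finset.sum_apply, Finset.sum_sub_distrib, Pi.smul_apply,
      smul_eq_mul]
    ring
  have hv0 : ∑ j, (∑ r, u r j - w j) = 0 := by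
    simp only [← hv]
    rw [Finset.sum_sub_distrib, hs.2, Finset.sum_comm, sub_eq_zero]
    exact Finset.sum_congr rfl fun r _ => (hz r).2.symm
  set c := QDSFM.l1Norm w with hc
  set d := ∑ r, QDSFM.l1Norm (u r) with hd
  have hcoord : ∀ i, ∑ r, (y - y') r i ^ 2 ≤ c ^ 2 + d ^ 2 := by
    intro i
    have h1 := QDSFM.sum_posPart_sub_le u (fun r j => y' r j - φ' r * b r j) w hv0 i (by
      simp only [← hv]; exact hloss i)
    have h2 : ∀ r, u r i - (y' r i - φ' r * b r i) = (y - y') r i := fun r => by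
      rw [← hyz]; simp
    have h3 : ∑ r, (y - y') r i = w i := by simp [hw, hsum]
    simp only [h2] at h1
    change _ ≤ (c + d - |w i| + w i) / 2 at h1
    have h4 := QDSFM.sum_sq_le_of_sum_posPart Finset.univ fun r => (y - y') r i
    rw [h3] at h4
    have h5 : w i ≤ ∑ r, max ((y - y') r i) 0 := by
      rw [← h3]; exact Finset.sum_le_sum fun r _ => le_max_left _ _
    have h6 : 0 ≤ ∑ r, max ((y - y') r i) 0 := Finset.sum_nonneg fun r _ => le_max_right _ _
    have h7 := pow_le_pow_left₀ h6
      (h1.trans (by linarith [le_abs_self (w i)] : _ ≤ (c + d) / 2)) 2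
    have h8 := pow_le_pow_left₀ (sub_nonneg.2 h5)
      (by linarith [neg_abs_le (w i)] : _ ≤ (c + d) / 2) 2
    -- `2 * ((c + d) / 2) ^ 2 ≤ c ^ 2 + d ^ 2`.
    nlinarith [sq_nonneg (c - d)]
  have hΔ : QDSFM.wNorm 1 (φ - φ') ^ 2 = ∑ r, (φ r - φ' r) ^ 2 := by
    rw [QDSFM.wNorm_sq fun i => by simp]; simp
  set Δ := QDSFM.wNorm 1 (φ - φ') ^ 2 with hΔ'
  have hd2 : d ^ 2 ≤ QDSFM.rho F ^ 2 * Δ := by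
    have h1 : d = ∑ r, |φ r - φ' r| * QDSFM.l1Norm (b r) :=
      Finset.sum_congr rfl fun r _ => by simp [hu, QDSFM.l1Norm, abs_mul, Finset.mul_sum]
    have h2 := Finset.sum_mul_sq_le_sq_mul_sq Finset.univ (fun r => |φ r - φ' r|)
      fun r => QDSFM.l1Norm (b r)
    simp only [sq_abs] at h2
    rw [← h1, ← hΔ] at h2
    rw [mul_comm]
    exact h2.trans (mul_le_mul_of_nonneg_left (QDSFM.sum_l1Norm_sq_le_rho_sq hb) (sq_nonneg _))
  have hc2 : c ^ 2 ≤ (∑ j, 1 / W₂ j j) * QDSFM.wNorm W₂ w ^ 2 := QDSFM.l1Norm_sq_le hW₂.2 w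
  set a := QDSFM.wNorm W₂ w ^ 2
  have ha : 0 ≤ a := sq_nonneg _
  have hΔ0 : 0 ≤ Δ := sq_nonneg _
  set A := ∑ i, W₁ i i with hA
  have hA0 : 0 ≤ A := Finset.sum_nonneg fun i _ => (hW₁.2 i).le
  have hmain : QDSFM.prodNorm W₁ (y - y') ^ 2 ≤ A * (c ^ 2 + d ^ 2) := by
    rw [QDSFM.prodNorm_sq fun i => (hW₁.2 i).le, hA, Finset.sum_mul]
    exact Finset.sum_le_sum fun i _ => mul_le_mul_of_nonneg_left (hcoord i) (hW₁.2 i).le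
  have hm1 : A * (∑ j, 1 / W₂ j j) ≤ QDSFM.mu F W₁ W₂ := le_max_left _ _
  -- The argument needs only the factor `1` in place of `9 / 4`; the summand `1` absorbs the term
  -- `Δ` on the left of the goal.
  have hm2 : A * QDSFM.rho F ^ 2 + 1 ≤ QDSFM.mu F W₁ W₂ := by
    refine le_trans ?_ (le_max_right _ _)
    have := mul_nonneg hA0 (sq_nonneg (QDSFM.rho F))
    linarith
  have k1 := mul_le_mul_of_nonneg_right hm1 ha
  have k2 := mul_le_mul_of_nonneg_right hm2 hΔ0
  have k3 := mul_le_mul_of_nonneg_left hc2 hA0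
  have k4 := mul_le_mul_of_nonneg_left hd2 hA0
  linarith
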